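/- Let $G$ be a finite connected graph (loops and parallel edges allowed), and let $M^\perp(G)$ be its cographic matroid: the matroid on the edge set $E(G)$ in which $A\subseteq E(G)$ is independent if and only if $G\setminus A$ (all vertices of $G$, the edges outside $A$) is connected. Suppose that $G$ contains a cycle $C$ (a subgraph homeomorphic to a circle) whose edge set has rank $d=\mathrm{rk}^\perp(E(C))$ in $M^\perp(G)$. Then for every choice of edge lengths $\ell:E(G)\to\mathbb{R}_{>0}$ the metric graph $\Gamma=(G,\ell)$ fails the degree-$d$ Manin–Mumford condition, and some degree-$d$ torsion packet on $\Gamma$ is infinite. Here $\mathrm{Div}(\Gamma)$ is the free abelian group on the points of $\Gamma$; for a continuous function $f:\Gamma\to\mathbb{R}$ that is piecewise linear with integer slopes, $\mathrm{Div}(f)$ is the divisor whose coefficient at each point is minus the sum of the outgoing slopes of $f$ there; $\mathrm{Pic}(\Gamma)$ is the quotient of $\mathrm{Div}(\Gamma)$ by the subgroup of all such $\mathrm{Div}(f)$, $[D]$ is the class of a divisor $D$, and $\mathrm{Jac}(\Gamma)\subseteq\mathrm{Pic}(\Gamma)$ is the group of classes of degree-$0$ divisors. The degree-$d$ Manin–Mumford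 condition says that for every effective divisor $D$ of degree $d$ the set $\{[x_1+\cdots+x_d-D] : x_1,\dots,x_d\in\Gamma\}$ contains only finitely many torsion points of $\mathrm{Jac}(\Gamma)$. The degree-$d$ torsion packet of an effective class $[D]$ of degree $d$ is the set of all classes $[D']$ of effective divisors $D'$ of degree $d$ such that $[D'-D]$ is torsion in $\mathrm{Jac}(\Gamma)$. -/

import Mathlib

/-- A multigraph with vertex set `V` and edge set `E`; loops and parallel edges are allowed.
Each edge carries an auxiliary orientation from its tail to its head. -/
structure Multigraph (V E : Type*) where
  tail : E → V
  head : E → V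

namespace Multigraph

variable {V E : Type*} (G : Multigraph V E)

/-- The edge `e` lies between `u` and `v`. -/
def Joins (e : E) (u v : V) : Prop :=
  (G.tail e = u ∧ G.head e = v) ∨ (G.tail e = v ∧ G.head e = u)

/-- The graph `G \ A`, with all vertices and the edges outside `A`, is connected. -/
def ConnectedDelete (A : Set E) : Prop :=
  Nonempty V ∧ ∀ u v : V, Relation.ReflTransGen (fun a b => ∃ e, e ∉ A ∧ G.Joins e a b) u v

/-- The graph `G` is connected. -/
def Connected : Prop := G.ConnectedDelete ∅

/-- `C` is the edge set of a cycle of `G`, i.e. of a subgraph homeomorphic to a circle: it consists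
of `n + 1 ≥ 1` distinct edges `e 0, …, e n` passing through distinct vertices `v 0, …, v n` in
cyclic order (addition in `Fin (n + 1)` is modulo `n + 1`). A loop is a cycle with one edge, two
parallel edges form a cycle with two edges. -/
def IsCycleEdgeSet (C : Set E) : Prop :=
  ∃ (n : ℕ) (v : Fin (n + 1) → V) (e : Fin (n + 1) → E),
    Function.Injective v ∧ Function.Injective e ∧
    (∀ i, G.Joins (e i) (v i) (v (i + 1))) ∧ C = Set.range e

/-- The cut space of `G`: all coboundaries of real functions on the vertices. -/
def cutSpace : Submodule ℝ (E → ℝ) :=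
  LinearMap.range (LinearMap.funLeft ℝ ℝ G.head - LinearMap.funLeft ℝ ℝ G.tail)

theorem linearIndepOn_iff_connectedDelete [Finite E] (hG : G.Connected) (A : Set E) :
    LinearIndepOn ℝ (fun e : E => G.cutSpace.mkQ (by classical exact Pi.single e 1)) A ↔
      G.ConnectedDelete A := by
  classical
  have := Fintype.ofFinite E
  have key : ∀ c : E →₀ ℝ, Finsupp.linearCombination ℝ
      (fun e : E => G.cutSpace.mkQ (by classical exact Pi.single e 1)) c
        = G.cutSpace.mkQ (c : E → ℝ) := by
    intro c
    rw [Finsupp.linearCombination_apply, Finsupp.sum_fintype _ _ (by simp)]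
    simp_rw [← map_smul]
    rw [← map_sum]
    congr 1
    funext x
    simp [Finset.sum_apply, Pi.single_apply]
  have hmem : ∀ c : E → ℝ, G.cutSpace.mkQ c = 0 ↔ ∃ f : V → ℝ,
      ∀ e, c e = f (G.head e) - f (G.tail e) := by
    intro c
    rw [Submodule.mkQ_apply, Submodule.Quotient.mk_eq_zero, cutSpace, LinearMap.mem_range]
    constructor
    · rintro ⟨f, rfl⟩
      exact ⟨f, fun e => by simp [LinearMap.funLeft_apply]⟩
    · rintro ⟨f, hf⟩
      exact ⟨f, by funext e; simp [LinearMap.funLeft_apply, hf]⟩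
  rw [linearIndepOn_iff]
  constructor
  · intro h
    refine ⟨hG.1, fun u v => ?_⟩
    set R := Relation.ReflTransGen (fun a b => ∃ e, e ∉ A ∧ G.Joins e a b) u with hR
    let f : V → ℝ := fun w => if R w then 1 else 0
    have hf : ∀ e, e ∉ A → f (G.head e) = f (G.tail e) := by
      intro e he
      have h1 : R (G.head e) ↔ R (G.tail e) :=
        ⟨fun h => h.tail ⟨e, he, Or.inr ⟨rfl, rfl⟩⟩, fun h => h.tail ⟨e, he, Or.inl ⟨rfl, rfl⟩⟩⟩
      simp only [f, h1]
    let c : E →₀ ℝ := Finsupp.equivFunOnFinite.symm (fun e => f (G.head e) - f (G.tail e))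
    have hc : c = 0 := by
      refine h c ?_ ?_
      · rw [Finsupp.mem_supported]
        intro e he
        by_contra hA
        have : c e = 0 := by simp [c, hf e hA]
        simp [this] at he
      · rw [key, hmem]
        exact ⟨f, fun e => by simp [c]⟩
    have hf' : ∀ e, f (G.head e) = f (G.tail e) := by
      intro e
      have : c e = 0 := by rw [hc]; rfl
      simpa [c, sub_eq_zero] using this
    have hconst : f v = f u := by
      induction hG.2 u v with
      | refl => rfl
      | tail _ hbc ih =>
        obtain ⟨e, -, he⟩ := hbc
        rw [← ih]
        rcases he with ⟨rfl, rfl⟩ | ⟨rfl, rfl⟩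
        · exact hf' e
        · exact (hf' e).symm
    have hu : R u := Relation.ReflTransGen.refl
    by_contra hv
    have hv' : ¬ R v := hv
    simp [f, hu, hv'] at hconst
  · intro h c hcA hc
    rw [key, hmem] at hc
    obtain ⟨f, hf⟩ := hc
    have hconst : ∀ u v, f v = f u := by
      intro u v
      induction h.2 u v with
      | refl => rfl
      | tail _ hbc ih =>
        obtain ⟨e, heA, he⟩ := hbc
        have h0 : c e = 0 := by
          by_contra h0
          exact heA ((Finsupp.mem_supported _ _).1 hcA (by simpa using h0))
        have h1 : f (G.head e) = f (G.tail e) := by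
          have := hf e
          rw [h0] at this
          linarith
        rw [← ih]
        rcases he with ⟨rfl, rfl⟩ | ⟨rfl, rfl⟩
        · exact h1
        · exact h1.symm
    ext e
    rw [hf e, hconst (G.tail e) (G.head e)]
    simp

theorem ConnectedDelete.subset {I J : Set E} (hJ : G.ConnectedDelete J) (h : I ⊆ J) :
    G.ConnectedDelete I :=
  ⟨hJ.1, fun u v => (hJ.2 u v).lift id
    (fun _ _ ⟨e, he, hj⟩ => ⟨e, fun hI => he (h hI), hj⟩)⟩

theorem ConnectedDelete.augment [Finite E] (hG : G.Connected) {I J : Set E}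
    (hI : G.ConnectedDelete I) (hJ : G.ConnectedDelete J) (hIJ : I.ncard < J.ncard) :
    ∃ e ∈ J, e ∉ I ∧ G.ConnectedDelete (insert e I) := by
  classical
  have := Fintype.ofFinite E
  simp only [← G.linearIndepOn_iff_connectedDelete hG] at hI hJ ⊢
  set w : E → (E → ℝ) ⧸ G.cutSpace :=
    fun e => G.cutSpace.mkQ (by classical exact Pi.single e 1) with hw
  have hex : ∃ e ∈ J, w e ∉ Submodule.span ℝ (w '' I) := by
    by_contra hcon
    push Not at hcon
    have hle : Submodule.span ℝ (w '' J) ≤ Submodule.span ℝ (w '' I) := by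
      rw [Submodule.span_le]
      rintro _ ⟨e, he, rfl⟩
      exact hcon e he
    have h1 := Submodule.finrank_mono hle
    have e1 : ∀ K : Set E, LinearIndepOn ℝ w K →
        Module.finrank ℝ (Submodule.span ℝ (w '' K)) = K.ncard := by
      intro K hK
      have := finrank_span_eq_card (R := ℝ) (b := fun x : K => w x) hK
      rw [Set.image_eq_range, this, Set.ncard_eq_toFinset_card', Set.toFinset_card]
    rw [e1 I hI, e1 J hJ] at h1
    omega
  obtain ⟨e, heJ, he⟩ := hex
  refine ⟨e, heJ, fun h => he (Submodule.subset_span ⟨e, h, rfl⟩), hI.insert he⟩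

/-- The cographic matroid of a connected graph: its ground set is the set of edges, and a set of
edges is independent when its removal does not disconnect the graph; so its bases are the
complements of the spanning trees. -/
noncomputable def cographicMatroid [Finite E] (hG : G.Connected) : Matroid E :=
  (IndepMatroid.ofFinite (E := Set.univ) Set.finite_univ G.ConnectedDelete hG
    (fun _ _ hJ h => ConnectedDelete.subset G hJ h)
    (fun _ _ hI hJ h => ConnectedDelete.augment G hG hI hJ h)
    (fun _ _ => Set.subset_univ _)).matroid

theorem cographicMatroid_indep_iff [Finite E] (hG : G.Connected) (A : Set E) :
    (G.cographicMatroid hG).Indep A ↔ G.ConnectedDelete A := Iff.rfl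

theorem cographicMatroid_ground [Finite E] (hG : G.Connected) :
    (G.cographicMatroid hG).E = Set.univ := rfl

end Multigraph

/-- A combinatorial model `(G, ℓ)` of a metric graph: a multigraph with positive edge lengths. -/
structure MetricGraph (V E : Type*) extends Multigraph V E where
  len : E → ℝ
  len_pos : ∀ e, 0 < len e

namespace MetricGraph

open Set

variable {V E : Type*} (Γ : MetricGraph V E)

/-- The points of the metric graph: its vertices, and on each edge `e` the interior points at
distance `t` from the tail, where `0 < t < ℓ(e)`. -/
inductive Point : Type _
  | vertex (v : V) : Point
  | interior (e : E) (t : ℝ) (h0 : 0 < t) (h1 : t < Γ.len e) : Point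

/-- The length-preserving parametrization of the closed edge `e` by `[0, ℓ(e)]`, from its tail to
its head (values of `t` outside this interval are never used). -/
noncomputable def edgePoint (e : E) (t : ℝ) : Γ.Point :=
  if h0 : 0 < t then
    if h1 : t < Γ.len e then Point.interior e t h0 h1 else Point.vertex (Γ.head e)
  else Point.vertex (Γ.tail e)

/-- `f` is piecewise `ℤ`-linear: every closed edge can be cut at finitely many points `B` so that
`f` is affine with integer slope on each closed piece. Since the pieces contain their endpoints
(in particular the vertices), such functions are continuous. -/
def IsPLZ (f : Γ.Point → ℝ) : Prop :=
  ∀ e, ∃ B : Finset ℝ, ∀ a b : ℝ, 0 ≤ a → a < b → b ≤ Γ.len e → (∀ t ∈ B, t ∉ Ioo a b) →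
    ∃ m : ℤ, ∀ t ∈ Icc a b, f (Γ.edgePoint e t) = f (Γ.edgePoint e a) + m * (t - a)

/-- The slope of `f` at the point at distance `t` from the tail of `e`, in the direction
towards the head of `e`. -/
noncomputable def slopeToHead (f : Γ.Point → ℝ) (e : E) (t : ℝ) : ℝ :=
  derivWithin (fun s => f (Γ.edgePoint e s)) (Ici t) t

/-- The slope of `f` at the point at distance `t` from the tail of `e`, in the direction
towards the tail of `e`. -/
noncomputable def slopeToTail (f : Γ.Point → ℝ) (e : E) (t : ℝ) : ℝ :=
  -derivWithin (fun s => f (Γ.edgePoint e s)) (Iic t) t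

open Classical in
/-- The coefficient of `Div(f)` at a point: minus the sum of the outgoing slopes of `f`.
A loop contributes both of its ends. -/
noncomputable def divisorOf [Fintype E] (f : Γ.Point → ℝ) : Γ.Point → ℝ
  | Point.vertex v =>
      -((∑ e with Γ.tail e = v, Γ.slopeToHead f e 0) +
        ∑ e with Γ.head e = v, Γ.slopeToTail f e (Γ.len e))
  | Point.interior e t _ _ => -(Γ.slopeToHead f e t + Γ.slopeToTail f e t)

/-- The group of divisors: the free abelian group on the points of the metric graph. -/
abbrev Divisor : Type _ := Γ.Point →₀ ℤ

variable {Γ}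

theorem exists_gap (B : Finset ℝ) {t u : ℝ} (h : t < u) :
    ∃ b, t < b ∧ b ≤ u ∧ ∀ s ∈ B, s ∉ Ioo t b := by
  classical
  induction B using Finset.induction_on with
  | empty => exact ⟨u, h, le_rfl, by simp⟩
  | insert x B _ ih =>
    obtain ⟨b, hb1, hb2, hb3⟩ := ih
    by_cases hx : t < x
    · refine ⟨min b x, lt_min hb1 hx, (min_le_left _ _).trans hb2, ?_⟩
      intro s hs hst
      rcases Finset.mem_insert.1 hs with rfl | hs
      · exact absurd hst.2 (not_lt.2 (min_le_right _ _))
      · exact hb3 s hs ⟨hst.1, hst.2.trans_le (min_le_left _ _)⟩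
    · refine ⟨b, hb1, hb2, ?_⟩
      intro s hs hst
      rcases Finset.mem_insert.1 hs with rfl | hs
      · exact hx hst.1
      · exact hb3 s hs hst

theorem exists_gap' (B : Finset ℝ) {t u : ℝ} (h : u < t) :
    ∃ a, u ≤ a ∧ a < t ∧ ∀ s ∈ B, s ∉ Ioo a t := by
  classical
  obtain ⟨b, h1, h2, h3⟩ := exists_gap (B.image Neg.neg) (neg_lt_neg h)
  refine ⟨-b, by linarith, by linarith, fun s hs hst => ?_⟩
  exact h3 (-s) (Finset.mem_image_of_mem _ hs) ⟨by linarith [hst.2], by linarith [hst.1]⟩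

theorem IsPLZ.differentiable_right {f : Γ.Point → ℝ} (hf : Γ.IsPLZ f) (e : E) {t : ℝ}
    (h0 : 0 ≤ t) (h1 : t < Γ.len e) :
    DifferentiableWithinAt ℝ (fun s => f (Γ.edgePoint e s)) (Ici t) t := by
  obtain ⟨B, hB⟩ := hf e
  obtain ⟨b, hb1, hb2, hb3⟩ := exists_gap B h1
  obtain ⟨m, hm⟩ := hB t b h0 hb1 hb2 hb3
  have hd : DifferentiableWithinAt ℝ (fun s => f (Γ.edgePoint e s)) (Icc t b) t :=
    DifferentiableWithinAt.congr (f := fun s => f (Γ.edgePoint e t) + m * (s - t))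
      (by fun_prop) (fun x hx => hm x hx) (hm t ⟨le_rfl, hb1.le⟩)
  exact hd.mono_of_mem_nhdsWithin (Icc_mem_nhdsGE hb1)

theorem IsPLZ.differentiable_left {f : Γ.Point → ℝ} (hf : Γ.IsPLZ f) (e : E) {t : ℝ}
    (h0 : 0 < t) (h1 : t ≤ Γ.len e) :
    DifferentiableWithinAt ℝ (fun s => f (Γ.edgePoint e s)) (Iic t) t := by
  obtain ⟨B, hB⟩ := hf e
  obtain ⟨a, ha1, ha2, ha3⟩ := exists_gap' B h0
  obtain ⟨m, hm⟩ := hB a t ha1 ha2 h1 ha3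
  have hd : DifferentiableWithinAt ℝ (fun s => f (Γ.edgePoint e s)) (Icc a t) t :=
    DifferentiableWithinAt.congr (f := fun s => f (Γ.edgePoint e a) + m * (s - a))
      (by fun_prop) (fun x hx => hm x hx) (hm t ⟨ha2.le, le_rfl⟩)
  exact hd.mono_of_mem_nhdsWithin (Icc_mem_nhdsLE ha2)

theorem IsPLZ.zero : Γ.IsPLZ (fun _ => 0) :=
  fun _ => ⟨∅, fun _ _ _ _ _ _ => ⟨0, fun _ _ => by simp⟩⟩

theorem IsPLZ.neg {f : Γ.Point → ℝ} (hf : Γ.IsPLZ f) : Γ.IsPLZ (fun x => -f x) := by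
  intro e
  obtain ⟨B, hB⟩ := hf e
  refine ⟨B, fun a b h0 h1 h2 h3 => ?_⟩
  obtain ⟨m, hm⟩ := hB a b h0 h1 h2 h3
  exact ⟨-m, fun t ht => by simp only [hm t ht]; push_cast; ring⟩

theorem IsPLZ.add {f g : Γ.Point → ℝ} (hf : Γ.IsPLZ f) (hg : Γ.IsPLZ g) :
    Γ.IsPLZ (fun x => f x + g x) := by
  classical
  intro e
  obtain ⟨B, hB⟩ := hf e
  obtain ⟨B', hB'⟩ := hg e
  refine ⟨B ∪ B', fun a b h0 h1 h2 h3 => ?_⟩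
  obtain ⟨m, hm⟩ := hB a b h0 h1 h2 (fun t ht => h3 t (Finset.mem_union_left _ ht))
  obtain ⟨m', hm'⟩ := hB' a b h0 h1 h2 (fun t ht => h3 t (Finset.mem_union_right _ ht))
  exact ⟨m + m', fun t ht => by simp only [hm t ht, hm' t ht]; push_cast; ring⟩

theorem divisorOf_zero [Fintype E] (x : Γ.Point) : Γ.divisorOf (fun _ => 0) x = 0 := by
  cases x <;> simp [divisorOf, slopeToHead, slopeToTail]

theorem divisorOf_neg [Fintype E] (f : Γ.Point → ℝ) (x : Γ.Point) :
    Γ.divisorOf (fun y => -f y) x = -Γ.divisorOf f x := by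
  cases x <;> simp [divisorOf, slopeToHead, slopeToTail, derivWithin.fun_neg] <;> ring

theorem divisorOf_add [Fintype E] {f g : Γ.Point → ℝ} (hf : Γ.IsPLZ f) (hg : Γ.IsPLZ g)
    (x : Γ.Point) : Γ.divisorOf (fun y => f y + g y) x = Γ.divisorOf f x + Γ.divisorOf g x := by
  have hH : ∀ e t, 0 ≤ t → t < Γ.len e → Γ.slopeToHead (fun y => f y + g y) e t =
      Γ.slopeToHead f e t + Γ.slopeToHead g e t := fun e t h0 h1 =>
    derivWithin_fun_add (hf.differentiable_right e h0 h1) (hg.differentiable_right e h0 h1)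
  have hT : ∀ e t, 0 < t → t ≤ Γ.len e → Γ.slopeToTail (fun y => f y + g y) e t =
      Γ.slopeToTail f e t + Γ.slopeToTail g e t := fun e t h0 h1 => by
    have := derivWithin_fun_add (hf.differentiable_left e h0 h1) (hg.differentiable_left e h0 h1)
    simp only [slopeToTail]
    rw [this]; ring
  cases x with
  | vertex v =>
    simp only [divisorOf, fun e => hH e 0 le_rfl (Γ.len_pos e),
      fun e => hT e (Γ.len e) (Γ.len_pos e) le_rfl, Finset.sum_add_distrib]
    ring
  | interior e t h0 h1 =>
    simp only [divisorOf, hH e t h0.le h1, hT e t h0 h1.le]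
    ring

variable (Γ) [Fintype E]

/-- The group of principal divisors `Div(f)`, for `f` piecewise `ℤ`-linear. -/
noncomputable def principal : AddSubgroup Γ.Divisor where
  carrier := {D | ∃ f, Γ.IsPLZ f ∧ ∀ x, (D x : ℝ) = Γ.divisorOf f x}
  zero_mem' := ⟨fun _ => 0, IsPLZ.zero, fun x => by simp [divisorOf_zero]⟩
  add_mem' := by
    rintro D D' ⟨f, hf, h⟩ ⟨g, hg, h'⟩
    exact ⟨_, hf.add hg, fun x => by simp [divisorOf_add hf hg, h, h']⟩
  neg_mem' := by
    rintro D ⟨f, hf, h⟩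
    exact ⟨_, hf.neg, fun x => by simp [divisorOf_neg, h]⟩

/-- The Picard group: divisors modulo linear equivalence. -/
abbrev Pic : Type _ := Γ.Divisor ⧸ Γ.principal

/-- The class `[D]` of a divisor `D`. -/
noncomputable abbrev divisorClass : Γ.Divisor →+ Γ.Pic := QuotientAddGroup.mk' Γ.principal

/-- The Jacobian: the group of divisor classes of degree zero. -/
noncomputable def Jac : AddSubgroup Γ.Pic :=
  (Finsupp.degree (σ := Γ.Point) (R := ℤ)).ker.map Γ.divisorClass

/-- The degree `d` Abel–Jacobi map `(x₁, …, x_d) ↦ [x₁ + ⋯ + x_d - D]` with base divisor `D`. -/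
noncomputable def abelJacobi {d : ℕ} (D : Γ.Divisor) (hD : D.degree = d)
    (x : Fin d → Γ.Point) : Γ.Jac :=
  ⟨Γ.divisorClass (∑ i, Finsupp.single (x i) 1 - D),
    AddSubgroup.mem_map_of_mem _ (by simp [AddMonoidHom.mem_ker, hD])⟩

/-- The degree `d` Manin–Mumford condition: for every effective divisor `D` of degree `d`, the image
of the degree `d` Abel–Jacobi map contains only finitely many torsion points of the Jacobian. -/
def ManinMumford (d : ℕ) : Prop :=
  ∀ (D : Γ.Divisor) (hD : D.degree = d), 0 ≤ D →
    (Set.range (Γ.abelJacobi D hD) ∩ {c : Γ.Jac | IsOfFinAddOrder c}).Finite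

/-- The set of effective divisor classes of degree `d`. -/
def Eff (d : ℕ) : Set Γ.Pic :=
  {c | ∃ D : Γ.Divisor, 0 ≤ D ∧ D.degree = d ∧ Γ.divisorClass D = c}

/-- The torsion packet of an effective class `c` of degree `d`: the effective classes of degree `d`
whose difference with `c` is a torsion point of the Jacobian. -/
def torsionPacket (d : ℕ) (c : Γ.Pic) : Set Γ.Pic :=
  {c' ∈ Γ.Eff d | ∃ j : Γ.Jac, IsOfFinAddOrder j ∧ (j : Γ.Pic) = c' - c}

end MetricGraph

/-! ### Integral flows on cycles and potentials from bridges -/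

namespace Multigraph

variable {V E : Type*}

/-! Let `A` be a basis of `C` in the cographic matroid, so `A` has `d` edges, `G \ A` is connected
and every edge of `C` outside `A` is a bridge of `G \ A`. Let `σ` be the unit flow around `C`.
Bridges impose no cycle condition, so a vertex potential `p` can be found whose differences are `σ e
* len e` on every edge outside `A`. The defect `c` between `σ e * len e` and the differences of `p`
is therefore supported on `A`.

Put one point on each edge of `A`, displaced from the midpoint by `q * c e`, and let `D_q` be the
sum of these `d` points. The displacements absorb the defect: for rational `q`, `q'` with `N * (q' -
q)` an integer, `N • (D_q - D_q')` is the divisor of a function with slope `N * (q' - q) * σ e` at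
the tail of each edge (`exists_isPLZ_of_flow`). Thus all differences are torsion. Morally, `D_q -
D_q'` represents the point `(q' - q) * σ` of the torus of real flows modulo integral flows.

These classes are distinct when all `q` lie in `(0, 1)`. If `D_q - D_q'` were the divisor of `g`,
then the function above minus `N * g` would be harmonic, hence of slope zero
(`IsPLZ.slopeToHead_eq_zero`), and `q' - q` would be an integer up to sign. Infinitely many small
`q` give an infinite torsion packet (`exists_torsion_family`). -/

theorem Joins.symm {G : Multigraph V E} {e : E} {u v : V} (h : G.Joins e u v) : G.Joins e v u :=
  Or.symm h

/-- A cycle carries an integral flow with values `±1` on its edges and `0` elsewhere. -/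
theorem IsCycleEdgeSet.exists_flow [Fintype E] [DecidableEq V] {G : Multigraph V E} {C : Set E}
    (hC : G.IsCycleEdgeSet C) :
    ∃ σ : E → ℤ, (∀ e ∈ C, σ e = 1 ∨ σ e = -1) ∧ (∀ e, e ∉ C → σ e = 0) ∧
      ∀ v, ∑ e with G.tail e = v, σ e = ∑ e with G.head e = v, σ e := by
  classical
  obtain ⟨n, v, e, -, he, hj, rfl⟩ := hC
  -- The sign compares the auxiliary orientation with the direction in which the cycle is traversed;
  -- a loop gets `+1`.
  let σ : E → ℤ := fun a => if h : ∃ i, e i = a then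
    if G.tail a = v h.choose ∧ G.head a = v (h.choose + 1) then 1 else -1 else 0
  have hσ : ∀ i, σ (e i) = if G.tail (e i) = v i ∧ G.head (e i) = v (i + 1) then 1 else -1 := by
    intro i
    have h : ∃ j, e j = e i := ⟨i, rfl⟩
    have h' : h.choose = i := he h.choose_spec
    simp only [σ, dif_pos h, h']
  have h0 : ∀ a, a ∉ Set.range e → σ a = 0 := fun a ha => dif_neg ha
  refine ⟨σ, ?_, h0, fun w => ?_⟩
  · rintro _ ⟨i, rfl⟩
    rw [hσ]
    split_ifs <;> simp
  · rw [Finset.sum_filter, Finset.sum_filter, ← sub_eq_zero, ← Finset.sum_sub_distrib,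
      ← Fintype.sum_of_injective e he _ _ (fun a ha => by simp [h0 a ha]) fun _ => rfl]
    -- Whatever its orientation, the `i`-th edge carries one unit out of `v i` and into `v (i + 1)`,
    -- so the sum cancels after a cyclic shift.
    have hterm : ∀ i, ((if G.tail (e i) = w then σ (e i) else 0) -
        (if G.head (e i) = w then σ (e i) else 0)) =
        (if v i = w then 1 else 0) - (if v (i + 1) = w then 1 else 0) := by
      intro i
      rw [hσ]
      rcases hj i with h | h
      · rw [if_pos h, h.1, h.2]
      · by_cases h' : G.tail (e i) = v i ∧ G.head (e i) = v (i + 1)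
        · rw [if_pos h', h'.1, h'.2]
        · rw [if_neg h', h.1, h.2]
          split_ifs <;> simp
    rw [Finset.sum_congr rfl fun i _ => hterm i, Finset.sum_sub_distrib,
      sub_eq_zero]
    exact (Fintype.sum_equiv (Equiv.addRight (1 : Fin (n + 1))) _ _ fun _ => rfl).symm

/-- The indicator of the side of a bridge `e` of `G \ A` that contains its head. -/
theorem ConnectedDelete.exists_bridge_potential {G : Multigraph V E} {A : Set E}
    (hA : G.ConnectedDelete A) {e : E} (he : ¬ G.ConnectedDelete (insert e A)) :
    ∃ p : V → ℝ, p (G.head e) - p (G.tail e) = 1 ∧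
      ∀ a, a ∉ A → a ≠ e → p (G.head a) = p (G.tail a) := by
  classical
  set R := Relation.ReflTransGen (fun x y => ∃ a, a ∉ insert e A ∧ G.Joins a x y) with hR
  have hsymm : ∀ x y, R x y → R y x := by
    intro x y h
    induction h with
    | refl => exact Relation.ReflTransGen.refl
    | tail _ hbc ih =>
      obtain ⟨a, ha, hj⟩ := hbc
      exact Relation.ReflTransGen.head ⟨a, ha, hj.symm⟩ ih
  -- A path from head to tail avoiding `e` would be a detour replacing every use of `e`, so `e`
  -- would not be a bridge.
  have hne : ¬ R (G.head e) (G.tail e) := by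
    intro h
    refine he ⟨hA.1, fun u v => ?_⟩
    induction hA.2 u v with
    | refl => exact Relation.ReflTransGen.refl
    | tail _ hbc ih =>
      obtain ⟨a, ha, hj⟩ := hbc
      by_cases hae : a = e
      · subst hae
        rcases hj with ⟨rfl, rfl⟩ | ⟨rfl, rfl⟩
        · exact ih.trans (hsymm _ _ h)
        · exact ih.trans h
      · exact ih.tail ⟨a, by simp [hae, ha], hj⟩
  refine ⟨fun w => if R (G.head e) w then 1 else 0, ?_, fun a ha hae => ?_⟩
  · have : R (G.head e) (G.head e) := Relation.ReflTransGen.refl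
    simp [this, hne]
  · have h1 : R (G.head e) (G.head a) ↔ R (G.head e) (G.tail a) :=
      ⟨fun h => h.tail ⟨a, by simp [hae, ha], Or.inr ⟨rfl, rfl⟩⟩,
        fun h => h.tail ⟨a, by simp [hae, ha], Or.inl ⟨rfl, rfl⟩⟩⟩
    simp only [h1]

/-- If every edge of `C` outside `A` is a bridge of `G \ A`, then there is a potential with
prescribed differences along these edges that is constant along the edges outside `C`. -/
theorem ConnectedDelete.exists_potential [Fintype E] {G : Multigraph V E} {A C : Set E}
    (hA : G.ConnectedDelete A) (hC : ∀ e ∈ C, e ∉ A → ¬ G.ConnectedDelete (insert e A))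
    (w : E → ℝ) (hw : ∀ e, e ∉ C → w e = 0) :
    ∃ p : V → ℝ, ∀ e, e ∉ A → p (G.head e) - p (G.tail e) = w e := by
  classical
  have h : ∀ e, ∃ p : V → ℝ, (e ∈ C → e ∉ A → p (G.head e) - p (G.tail e) = 1) ∧
      ∀ a, a ∉ A → (a ≠ e ∨ e ∉ C) → p (G.head a) = p (G.tail a) := by
    intro e
    by_cases he : e ∈ C ∧ e ∉ A
    · obtain ⟨p, h1, h2⟩ := hA.exists_bridge_potential (hC e he.1 he.2)
      exact ⟨p, fun _ _ => h1, fun a ha hae => h2 a ha (by tauto)⟩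
    · exact ⟨0, fun h1 h2 => absurd ⟨h1, h2⟩ he, fun _ _ _ => rfl⟩
  choose p hp1 hp2 using h
  -- Superposition: outside `A`, the potential of one bridge jumps on no other edge, so the
  -- prescribed differences do not interfere.
  refine ⟨fun v => ∑ e, w e * p e v, fun e he => ?_⟩
  rw [← Finset.sum_sub_distrib, Finset.sum_eq_single e]
  · rw [← mul_sub]
    by_cases hc : e ∈ C
    · rw [hp1 e hc he, mul_one]
    · rw [hw e hc, zero_mul]
  · intro b _ hb
    rw [← mul_sub, hp2 b e he (Or.inl hb.symm), sub_self, mul_zero]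
  · simp

end Multigraph

/-! ### Affine pieces and the maximum principle -/

namespace MetricGraph

open Set

variable {V E : Type*} {Γ : MetricGraph V E}

@[simp]
theorem edgePoint_zero (e : E) : Γ.edgePoint e 0 = Point.vertex (Γ.tail e) := by
  simp [edgePoint]

@[simp]
theorem edgePoint_len (e : E) : Γ.edgePoint e (Γ.len e) = Point.vertex (Γ.head e) := by
  simp [edgePoint, Γ.len_pos e]

theorem edgePoint_of_mem (e : E) {t : ℝ} (h : t ∈ Ioo 0 (Γ.len e)) :
    Γ.edgePoint e t = Point.interior e t h.1 h.2 := by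
  simp [edgePoint, h.1, h.2]

/-- The integrality of the slope is what matters: it feeds the intermediate value argument on a
single edge and, later, the proof that the classes are distinct. -/
theorem IsPLZ.exists_hasDerivWithinAt_Ici {f : Γ.Point → ℝ} (hf : Γ.IsPLZ f) (e : E) {t : ℝ}
    (h0 : 0 ≤ t) (h1 : t < Γ.len e) :
    ∃ m : ℤ, HasDerivWithinAt (fun s => f (Γ.edgePoint e s)) m (Ici t) t := by
  obtain ⟨B, hB⟩ := hf e
  obtain ⟨b, hb1, hb2, hb3⟩ := exists_gap B h1
  obtain ⟨m, hm⟩ := hB t b h0 hb1 hb2 hb3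
  have hd : HasDerivWithinAt (fun s => f (Γ.edgePoint e t) + m * (s - t)) (m : ℝ) (Icc t b) t := by
    simpa using ((((hasDerivAt_id t).sub_const t).const_mul (m : ℝ)).const_add
      (f (Γ.edgePoint e t))).hasDerivWithinAt
  exact ⟨m, (hd.congr (fun x hx => hm x hx) (hm t ⟨le_rfl, hb1.le⟩)).mono_of_mem_nhdsWithin
    (Icc_mem_nhdsGE hb1)⟩

theorem IsPLZ.exists_slopeToHead_eq {f : Γ.Point → ℝ} (hf : Γ.IsPLZ f) (e : E) {t : ℝ}
    (h0 : 0 ≤ t) (h1 : t < Γ.len e) : ∃ m : ℤ, Γ.slopeToHead f e t = m := by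
  obtain ⟨m, hm⟩ := hf.exists_hasDerivWithinAt_Ici e h0 h1
  exact ⟨m, hm.derivWithin (uniqueDiffWithinAt_Ici t)⟩

/-- A piecewise linear function without bends in the interior of an edge is affine on it. -/
theorem IsPLZ.exists_affine [Fintype E] {f : Γ.Point → ℝ} (hf : Γ.IsPLZ f) (e : E)
    (h : ∀ t h0 h1, Γ.divisorOf f (Point.interior e t h0 h1) = 0) :
    ∃ m : ℝ, ∀ t ∈ Icc 0 (Γ.len e), f (Γ.edgePoint e t) = f (Γ.edgePoint e 0) + m * t := by
  set F : ℝ → ℝ := fun s => f (Γ.edgePoint e s) with hF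
  have hd : ∀ t ∈ Ico 0 (Γ.len e), ∃ m : ℤ,
      HasDerivWithinAt F m (Ici t) t ∧ HasDerivWithinAt F m (Ico 0 (Γ.len e)) t := by
    intro t ht
    obtain ⟨m, hm⟩ := hf.exists_hasDerivWithinAt_Ici e ht.1 ht.2
    refine ⟨m, hm, ?_⟩
    rcases ht.1.lt_or_eq with h0 | rfl
    · have h1 := h t h0 ht.2
      have h2 : Γ.slopeToHead f e t = m := hm.derivWithin (uniqueDiffWithinAt_Ici t)
      have h3 := (hf.differentiable_left e h0 ht.2.le).hasDerivWithinAt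
      -- A vanishing divisor coefficient says that the left and right slopes agree, so the one-sided
      -- derivative is two-sided in the interior.
      have h4 : derivWithin F (Iic t) t = m := by
        simp only [divisorOf, h2, slopeToTail] at h1
        linarith
      rw [h4] at h3
      exact (hm.union h3).mono fun x _ => (le_total t x)
    · exact hm.mono Ico_subset_Ici_self
  choose! m hm hm' using hd
  have hconst : ∀ x ∈ Ico 0 (Γ.len e), ∀ y ∈ Ico 0 (Γ.len e), m x ≤ m y := by
    intro x hx y hy
    by_contra! hlt
    -- By Darboux, the values of a derivative on an interval form an interval; if two integer values
    -- differed, the half-integer `m y + 1 / 2` would also be attained.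
    have hoc := (ordConnected_Ico (a := 0) (b := Γ.len e)).image_hasDerivWithinAt hm'
    have hle : (m y : ℝ) + 1 ≤ m x := by exact_mod_cast hlt
    obtain ⟨z, -, hz⟩ := hoc.out ⟨y, hy, rfl⟩ ⟨x, hx, rfl⟩
      (show (m y : ℝ) + 1 / 2 ∈ _ from ⟨by linarith, by linarith⟩)
    have h2 : 2 * m z = 2 * m y + 1 := by
      have : (2 : ℝ) * m z = 2 * m y + 1 := by simp only at hz; linarith
      exact_mod_cast this
    omega
  have h0 : (0 : ℝ) ∈ Ico 0 (Γ.len e) := ⟨le_rfl, Γ.len_pos e⟩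
  have hcont : ContinuousOn F (Icc 0 (Γ.len e)) := by
    intro t ht
    have hr : ContinuousWithinAt F (Ici t ∩ Icc 0 (Γ.len e)) t := by
      rcases ht.2.lt_or_eq with hlt | rfl
      · exact (hf.differentiable_right e ht.1 hlt).continuousWithinAt.mono inter_subset_left
      · refine (continuousWithinAt_singleton (f := F)).mono ?_
        rintro x ⟨h1, h2⟩
        exact le_antisymm h2.2 h1
    have hl : ContinuousWithinAt F (Iic t ∩ Icc 0 (Γ.len e)) t := by
      rcases ht.1.lt_or_eq with hlt | rfl
      · exact (hf.differentiable_left e hlt ht.2).continuousWithinAt.mono inter_subset_left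
      · refine (continuousWithinAt_singleton (f := F)).mono ?_
        rintro x ⟨h1, h2⟩
        exact le_antisymm h1 h2.1
    have := hl.union hr
    rwa [← union_inter_distrib_right, Iic_union_Ici, univ_inter] at this
  refine ⟨m 0, fun t ht => ?_⟩
  have hg : ∀ x ∈ Icc 0 (Γ.len e), F x - m 0 * x = F 0 - m 0 * 0 := by
    refine constant_of_has_deriv_right_zero (hcont.sub (by fun_prop)) fun x hx => ?_
    have hx0 : m x = m 0 := le_antisymm (hconst x hx 0 h0) (hconst 0 h0 x hx)
    simpa [hx0] using (hm x hx).fun_sub (((hasDerivAt_id x).const_mul (m 0 : ℝ)).hasDerivWithinAt)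
  have := hg t ht
  simp only [hF] at this
  linarith

/-- A harmonic function on a connected metric graph has slope zero along every edge. -/
theorem IsPLZ.slopeToHead_eq_zero [Finite V] [Fintype E] {f : Γ.Point → ℝ} (hf : Γ.IsPLZ f)
    (hG : Γ.Connected) (h : ∀ x, Γ.divisorOf f x = 0) (e : E) : Γ.slopeToHead f e 0 = 0 := by
  classical
  choose m hm using fun e => hf.exists_affine e fun t h0 h1 => h (Point.interior e t h0 h1)
  have haff : ∀ e, ∀ t ∈ Icc 0 (Γ.len e),
      HasDerivWithinAt (fun s => f (Γ.edgePoint e s)) (m e) (Icc 0 (Γ.len e)) t := by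
    intro e t ht
    have := (((hasDerivAt_id t).const_mul (m e)).const_add
      (f (Γ.edgePoint e 0))).hasDerivWithinAt (s := Icc 0 (Γ.len e))
    rw [mul_one] at this
    exact this.congr (fun x hx => hm e x hx) (hm e t ht)
  have hH : ∀ e, Γ.slopeToHead f e 0 = m e := fun e =>
    ((haff e 0 ⟨le_rfl, (Γ.len_pos e).le⟩).mono_of_mem_nhdsWithin
      (Icc_mem_nhdsGE (Γ.len_pos e))).derivWithin (uniqueDiffWithinAt_Ici 0)
  have hT : ∀ e, Γ.slopeToTail f e (Γ.len e) = -m e := fun e => by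
    rw [slopeToTail, ((haff e _ ⟨(Γ.len_pos e).le, le_rfl⟩).mono_of_mem_nhdsWithin
      (Icc_mem_nhdsLE (Γ.len_pos e))).derivWithin (uniqueDiffWithinAt_Iic _)]
  have hends : ∀ e, f (Point.vertex (Γ.head e)) =
      f (Point.vertex (Γ.tail e)) + m e * Γ.len e := fun e => by
    simpa using hm e (Γ.len e) ⟨(Γ.len_pos e).le, le_rfl⟩
  have : Nonempty V := hG.1
  -- Maximum principle: at a vertex of maximal value all outgoing slopes are nonpositive and sum to
  -- zero, so they vanish; the maximum then spreads to the neighbours and, by connectedness,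
  -- everywhere.
  obtain ⟨v₀, hv₀⟩ := Finite.exists_max fun v => f (Point.vertex v)
  have hle : ∀ e, f (Point.vertex (Γ.tail e)) = f (Point.vertex v₀) → m e ≤ 0 := fun e he => by
    have h1 := hv₀ (Γ.head e)
    rw [hends, he] at h1
    by_contra! h2
    nlinarith [Γ.len_pos e, mul_pos h2 (Γ.len_pos e)]
  have hge : ∀ e, f (Point.vertex (Γ.head e)) = f (Point.vertex v₀) → 0 ≤ m e := fun e he => by
    have h1 := hv₀ (Γ.tail e)
    rw [← he, hends] at h1
    by_contra! h2
    nlinarith [Γ.len_pos e, mul_neg_of_neg_of_pos h2 (Γ.len_pos e)]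
  have hzero : ∀ v, f (Point.vertex v) = f (Point.vertex v₀) →
      ∀ e, Γ.tail e = v ∨ Γ.head e = v → m e = 0 := by
    intro v hv
    have hsum := h (Point.vertex v)
    simp only [divisorOf, hH, hT] at hsum
    have h1 : ∀ e ∈ Finset.univ.filter (fun e => Γ.tail e = v), m e ≤ 0 := fun e he =>
      hle e (by rw [(Finset.mem_filter.1 he).2, hv])
    have h2 : ∀ e ∈ Finset.univ.filter (fun e => Γ.head e = v), -m e ≤ 0 := fun e he =>
      neg_nonpos.2 (hge e (by rw [(Finset.mem_filter.1 he).2, hv]))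
    have h3 := Finset.sum_nonpos h1
    have h4 := Finset.sum_nonpos h2
    intro e he
    rcases he with he | he
    · exact (Finset.sum_eq_zero_iff_of_nonpos h1).1 (by linarith) e (by simp [he])
    · exact neg_eq_zero.1
        ((Finset.sum_eq_zero_iff_of_nonpos h2).1 (by linarith) e (by simp [he]))
  have hall : ∀ v, f (Point.vertex v) = f (Point.vertex v₀) := by
    intro v
    induction hG.2 v₀ v with
    | refl => rfl
    | tail _ hbc ih =>
      obtain ⟨e, -, ⟨rfl, rfl⟩ | ⟨rfl, rfl⟩⟩ := hbc
      · rw [hends, hzero _ ih e (Or.inl rfl), zero_mul, add_zero, ih]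
      · have := hends e
        rwa [hzero _ ih e (Or.inr rfl), zero_mul, add_zero, ih, eq_comm] at this
  rw [hH, hzero _ (hall _) e (Or.inl rfl)]

end MetricGraph

/-! ### One-sided derivatives of a ramp -/

open Set in
theorem hasDerivWithinAt_max_sub_zero_Ici (a t : ℝ) :
    HasDerivWithinAt (fun s => max (s - a) 0) (if a ≤ t then 1 else 0) (Ici t) t := by
  split_ifs with h
  · refine ((hasDerivAt_id t).sub_const a).hasDerivWithinAt.congr (fun x hx => ?_) ?_
    · exact max_eq_left (sub_nonneg.2 (h.trans hx))
    · exact max_eq_left (sub_nonneg.2 h)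
  · rw [not_le] at h
    refine ((hasDerivAt_const t (0 : ℝ)).congr_of_eventuallyEq ?_).hasDerivWithinAt
    filter_upwards [Iio_mem_nhds h] with x hx
    exact max_eq_right (sub_nonpos.2 (le_of_lt hx))

-- The strict inequality here, against the weak one on the right, records the kink: the two slopes
-- differ only at `t = a`.
open Set in
theorem hasDerivWithinAt_max_sub_zero_Iic (a t : ℝ) :
    HasDerivWithinAt (fun s => max (s - a) 0) (if a < t then 1 else 0) (Iic t) t := by
  split_ifs with h
  · refine (((hasDerivAt_id t).sub_const a).congr_of_eventuallyEq ?_).hasDerivWithinAt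
    filter_upwards [Ioi_mem_nhds h] with x hx
    exact max_eq_left (sub_nonneg.2 (le_of_lt hx))
  · rw [not_lt] at h
    refine (hasDerivAt_const t (0 : ℝ)).hasDerivWithinAt.congr (fun x hx => ?_) ?_
    · exact max_eq_right (sub_nonpos.2 (le_trans hx h))
    · exact max_eq_right (sub_nonpos.2 h)

open Set in
theorem exists_int_max_sub_zero_eq (c : ℝ) {a b : ℝ} (h : c ∉ Ioo a b) :
    ∃ m : ℤ, ∀ t ∈ Icc a b, max (t - c) 0 = max (a - c) 0 + m * (t - a) := by
  rcases le_or_gt c a with hc | hc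
  · refine ⟨1, fun t ht => ?_⟩
    rw [max_eq_left (by linarith [ht.1]), max_eq_left (by linarith)]
    push_cast
    ring
  · have hb : b ≤ c := not_lt.1 fun hb => h ⟨hc, hb⟩
    refine ⟨0, fun t ht => ?_⟩
    rw [max_eq_right (by linarith [ht.2]), max_eq_right (by linarith)]
    simp

/-! ### Functions with prescribed slopes and divisor -/

namespace MetricGraph

open Set

variable {V E : Type*} {Γ : MetricGraph V E}

variable (Γ) in
/-- The function on the metric graph with given values at the vertices and along the edges. -/
def glue (g : V → ℝ) (φ : E → ℝ → ℝ) : Γ.Point → ℝ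
  | Point.vertex v => g v
  | Point.interior e t _ _ => φ e t

theorem glue_edgePoint {g : V → ℝ} {φ : E → ℝ → ℝ} (h0 : ∀ e, φ e 0 = g (Γ.tail e))
    (h1 : ∀ e, φ e (Γ.len e) = g (Γ.head e)) (e : E) {t : ℝ} (ht : t ∈ Icc 0 (Γ.len e)) :
    Γ.glue g φ (Γ.edgePoint e t) = φ e t := by
  rcases ht.1.lt_or_eq with h | rfl
  · rcases ht.2.lt_or_eq with h' | rfl
    · rw [edgePoint_of_mem e ⟨h, h'⟩, glue]
    · rw [edgePoint_len, glue, h1]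
  · rw [edgePoint_zero, glue, h0]

open Classical in
theorem single_edgePoint_apply_interior {e e' : E} {a t : ℝ} (ha : a ∈ Ioo 0 (Γ.len e))
    (h0 : 0 < t) (h1 : t < Γ.len e') (n : ℤ) :
    Finsupp.single (Γ.edgePoint e a) n (Point.interior e' t h0 h1) =
      if e = e' then if a = t then n else 0 else 0 := by
  rw [edgePoint_of_mem e ha, Finsupp.single_apply, Point.interior.injEq]
  split_ifs <;> simp_all

theorem single_edgePoint_apply_vertex {e : E} {a : ℝ} (ha : a ∈ Ioo 0 (Γ.len e)) (v : V) (n : ℤ) :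
    Finsupp.single (Γ.edgePoint e a) n (Point.vertex v) = 0 := by
  rw [edgePoint_of_mem e ha, Finsupp.single_eq_of_ne (by simp)]

/-- Given an integral flow `k` and two points `a e`, `b e` inside each edge, there is a piecewise
linear function with slope `k e` along each edge `e`, except that the slope is changed by `N`
between the two points, provided that this is consistent with the given values at the vertices. -/
theorem exists_isPLZ_of_flow [Fintype E] [DecidableEq V] (g : V → ℝ) (k : E → ℤ)
    (hk : ∀ v, ∑ e with Γ.tail e = v, k e = ∑ e with Γ.head e = v, k e) (N : ℤ) (a b : E → ℝ)
    (ha : ∀ e, a e ∈ Ioo 0 (Γ.len e)) (hb : ∀ e, b e ∈ Ioo 0 (Γ.len e))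
    (hg : ∀ e, g (Γ.head e) = g (Γ.tail e) + k e * Γ.len e + N * (a e - b e)) :
    ∃ f, Γ.IsPLZ f ∧ (∀ e, Γ.slopeToHead f e 0 = k e) ∧
      ∀ x, (((N • (∑ e, Finsupp.single (Γ.edgePoint e (a e)) 1 -
        ∑ e, Finsupp.single (Γ.edgePoint e (b e)) 1) : Γ.Divisor) x : ℤ) : ℝ) =
          Γ.divisorOf f x := by
  classical
  -- The slope rises by `N` at `b e` and drops by `N` at `a e`, giving divisor coefficients `-N` and
  -- `N`. The total gain along the edge is `k e * len e + N * (a e - b e)`, which is what `hg`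
  -- requires.
  set φ : E → ℝ → ℝ := fun e t =>
    g (Γ.tail e) + k e * t + N * (max (t - b e) 0 - max (t - a e) 0) with hφ
  set f := Γ.glue g φ with hf
  have hφ0 : ∀ e, φ e 0 = g (Γ.tail e) := fun e => by
    simp only [hφ]
    rw [max_eq_right (by linarith [(hb e).1]), max_eq_right (by linarith [(ha e).1])]
    ring
  have hφ1 : ∀ e, φ e (Γ.len e) = g (Γ.head e) := fun e => by
    simp only [hφ]
    rw [max_eq_left (by linarith [(hb e).2]), max_eq_left (by linarith [(ha e).2]), hg e]
    ring
  have hfe : ∀ e, ∀ t ∈ Icc 0 (Γ.len e), f (Γ.edgePoint e t) = φ e t := fun e t ht =>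
    glue_edgePoint hφ0 hφ1 e ht
  have hH : ∀ e t, 0 ≤ t → t < Γ.len e → Γ.slopeToHead f e t =
      k e + N * ((if b e ≤ t then 1 else 0) - if a e ≤ t then 1 else 0) := by
    intro e t h0 h1
    have h2 : HasDerivWithinAt (φ e)
        (k e + N * ((if b e ≤ t then 1 else 0) - if a e ≤ t then 1 else 0)) (Ici t) t := by
      have := (((hasDerivAt_id t).const_mul (k e : ℝ)).const_add
        (g (Γ.tail e))).hasDerivWithinAt (s := Ici t)
      rw [mul_one] at this
      exact this.fun_add (((hasDerivWithinAt_max_sub_zero_Ici (b e) t).fun_sub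
        (hasDerivWithinAt_max_sub_zero_Ici (a e) t)).const_mul (N : ℝ))
    refine (h2.congr_of_eventuallyEq ?_ (hfe e t ⟨h0, h1.le⟩)).derivWithin
      (uniqueDiffWithinAt_Ici t)
    filter_upwards [Icc_mem_nhdsGE h1] with x hx
    exact hfe e x ⟨h0.trans hx.1, hx.2⟩
  have hT : ∀ e t, 0 < t → t ≤ Γ.len e → Γ.slopeToTail f e t =
      -(k e + N * ((if b e < t then 1 else 0) - if a e < t then 1 else 0)) := by
    intro e t h0 h1
    have h2 : HasDerivWithinAt (φ e)
        (k e + N * ((if b e < t then 1 else 0) - if a e < t then 1 else 0)) (Iic t) t := by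
      have := (((hasDerivAt_id t).const_mul (k e : ℝ)).const_add
        (g (Γ.tail e))).hasDerivWithinAt (s := Iic t)
      rw [mul_one] at this
      exact this.fun_add (((hasDerivWithinAt_max_sub_zero_Iic (b e) t).fun_sub
        (hasDerivWithinAt_max_sub_zero_Iic (a e) t)).const_mul (N : ℝ))
    refine congrArg Neg.neg ((h2.congr_of_eventuallyEq ?_ (hfe e t ⟨h0.le, h1⟩)).derivWithin
      (uniqueDiffWithinAt_Iic t))
    filter_upwards [Icc_mem_nhdsLE h0] with x hx
    exact hfe e x ⟨hx.1, hx.2.trans h1⟩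
  have hH0 : ∀ e, Γ.slopeToHead f e 0 = k e := fun e => by
    rw [hH e 0 le_rfl (Γ.len_pos e), if_neg (not_le.2 (ha e).1), if_neg (not_le.2 (hb e).1)]
    simp
  have hT1 : ∀ e, Γ.slopeToTail f e (Γ.len e) = -k e := fun e => by
    rw [hT e _ (Γ.len_pos e) le_rfl, if_pos (ha e).2, if_pos (hb e).2]
    simp
  refine ⟨f, fun e => ⟨{a e, b e}, fun x y h0 hxy h1 hB => ?_⟩, hH0, ?_⟩
  · obtain ⟨m, hm⟩ := exists_int_max_sub_zero_eq (a e) (hB _ (by simp))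
    obtain ⟨m', hm'⟩ := exists_int_max_sub_zero_eq (b e) (hB _ (by simp))
    refine ⟨k e + N * (m' - m), fun t ht => ?_⟩
    rw [hfe e t ⟨h0.trans ht.1, ht.2.trans h1⟩, hfe e x ⟨h0, hxy.le.trans h1⟩]
    simp only [hφ]
    rw [hm t ht, hm' t ht]
    push_cast
    ring
  · rintro (v | ⟨e, t, h0, h1⟩)
    -- No bend lies at a vertex, so the coefficient there is the net flow of `k`, which is zero.
    · have hkv : (∑ e with Γ.tail e = v, (k e : ℝ)) = ∑ e with Γ.head e = v, (k e : ℝ) := by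
        exact_mod_cast hk v
      simp only [divisorOf, hH0, hT1, Finset.sum_neg_distrib]
      simp only [Finsupp.smul_apply, Finsupp.sub_apply, Finsupp.finsetSum_apply,
        single_edgePoint_apply_vertex (ha _), single_edgePoint_apply_vertex (hb _)]
      rw [← sub_eq_add_neg, eq_comm]
      convert neg_eq_zero.2 (sub_eq_zero.2 hkv) using 1
      · congr! 3 <;> ext <;> simp
      · simp
    · simp only [divisorOf, hH e t h0.le h1, hT e t h0 h1.le, Finsupp.smul_apply,
        Finsupp.sub_apply, Finsupp.finsetSum_apply, single_edgePoint_apply_interior (ha _),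
        single_edgePoint_apply_interior (hb _), Finset.sum_ite_eq', Finset.mem_univ, if_true]
      -- Right slope minus left slope of a ramp is the indicator of its kink; this also covers `a e
      -- = b e`.
      have key : ∀ c : ℝ, (if c ≤ t then (1 : ℝ) else 0) - (if c < t then 1 else 0) =
          ((if c = t then 1 else 0 : ℤ) : ℝ) := by
        intro c
        rcases lt_trichotomy c t with h | h | h
        · simp [h, h.le, h.ne]
        · simp [h]
        · simp [h.not_ge, h.not_gt, h.ne']
      rw [smul_eq_mul, Int.cast_mul, Int.cast_sub, ← key, ← key]
      ring

theorem IsPLZ.int_mul {f : Γ.Point → ℝ} (hf : Γ.IsPLZ f) (n : ℤ) : Γ.IsPLZ (fun x => n * f x) := by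
  intro e
  obtain ⟨B, hB⟩ := hf e
  refine ⟨B, fun a b h0 h1 h2 h3 => ?_⟩
  obtain ⟨m, hm⟩ := hB a b h0 h1 h2 h3
  exact ⟨n * m, fun t ht => by simp only [hm t ht]; push_cast; ring⟩

end MetricGraph

/-! ### The infinite family of torsion translates -/

namespace MetricGraph

open Set

variable {V E : Type*} {Γ : MetricGraph V E} [Fintype E]

theorem divisorOf_int_mul (f : Γ.Point → ℝ) (n : ℤ) (x : Γ.Point) :
    Γ.divisorOf (fun y => n * f y) x = n * Γ.divisorOf f x := by
  cases x <;> simp only [divisorOf, slopeToHead, slopeToTail, derivWithin_const_mul_field,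
    ← mul_neg, ← Finset.mul_sum] <;> ring

/-- On a cycle of cographic rank `d` there are infinitely many pairwise inequivalent effective
divisors of degree `d` whose differences are torsion. -/
theorem exists_torsion_family [Finite V] (hG : Γ.Connected) {C : Set E}
    (hC : Γ.IsCycleEdgeSet C) {d : ℕ} (hd : (Γ.cographicMatroid hG).eRk C = d) :
    ∃ x : ℕ → Fin d → Γ.Point,
      (∀ i j, ∃ N : ℕ, 0 < N ∧ N • (Γ.divisorClass (∑ l, Finsupp.single (x i l) 1) -
        Γ.divisorClass (∑ l, Finsupp.single (x j l) 1)) = 0) ∧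
      Function.Injective fun i => Γ.divisorClass (∑ l, Finsupp.single (x i l) 1) := by
  classical
  obtain ⟨A, hA⟩ := (Γ.cographicMatroid hG).exists_isBasis C (subset_univ C)
  have hAcard : A.encard = d := by rw [hA.encard_eq_eRk, hd]
  let ε : Fin d ≃ A := (Finite.equivFinOfCardEq (by
    rw [Nat.card_coe_set_eq, ncard, hAcard, ENat.toNat_natCast])).symm
  obtain ⟨σ, hσ, hσ0, hflow⟩ := hC.exists_flow
  -- Maximality of the basis makes each edge of `C` outside `A` a bridge of `G \ A`.
  obtain ⟨p, hp⟩ := Multigraph.ConnectedDelete.exists_potential (G := Γ.toMultigraph)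
    hA.indep (fun e heC heA h => heA (hA.mem_of_insert_indep heC h))
    (fun e => σ e * Γ.len e) (fun e he => by simp [hσ0 e he])
  obtain ⟨e₀, he₀⟩ : C.Nonempty := by
    obtain ⟨n, v, e, -, -, -, rfl⟩ := hC
    exact range_nonempty e
  set c : E → ℝ := fun e => σ e * Γ.len e - (p (Γ.head e) - p (Γ.tail e)) with hc
  have hcA : ∀ e, e ∉ A → c e = 0 := fun e he => by simp only [hc, hp e he, sub_self]
  -- A bound `K > 2 * |c e| / len e` with `q i * K ≤ 1` keeps each displacement below half the edge
  -- length.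
  obtain ⟨M, hM⟩ := Finite.exists_le fun e => 2 * |c e| / Γ.len e
  obtain ⟨K, hK⟩ := exists_nat_gt M
  -- The summand `2` gives `q i < 1` even when `K = i = 0`, so that differences of the `q i` have
  -- absolute value less than `1`.
  let q : ℕ → ℚ := fun i => 1 / ((K + i + 2 : ℕ) : ℚ)
  have hq0 : ∀ i, 0 < q i := fun i => by positivity
  have hq1 : ∀ i, q i < 1 := fun i => by
    simp only [q]
    rw [div_lt_one (by positivity)]
    push_cast
    have : (0 : ℚ) ≤ K + i := by positivity
    linarith
  have hqinj : Function.Injective q := fun i j hij => by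
    have : ((K + i + 2 : ℕ) : ℚ) = (K + j + 2 : ℕ) := by
      simpa [q] using hij
    have := Nat.cast_injective this
    omega
  let t : ℕ → E → ℝ := fun i e => Γ.len e / 2 + q i * c e
  have ht : ∀ i e, t i e ∈ Ioo 0 (Γ.len e) := by
    intro i e
    have hl := Γ.len_pos e
    have h1 : 2 * |c e| < K * Γ.len e := (div_lt_iff₀ hl).1 ((hM e).trans_lt hK)
    have h2 : (q i : ℝ) * K ≤ 1 := by
      simp only [q]
      push_cast
      rw [one_div_mul_eq_div, div_le_one (by positivity)]
      have : (0 : ℝ) ≤ i := by positivity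
      linarith
    have h3 : (0 : ℝ) < q i := by exact_mod_cast hq0 i
    have h4 : 2 * |q i * c e| < Γ.len e := by
      rw [abs_mul, abs_of_pos h3]
      calc 2 * (q i * |c e|) = q i * (2 * |c e|) := by ring
        _ < q i * (K * Γ.len e) := by gcongr
        _ = q i * K * Γ.len e := by ring
        _ ≤ 1 * Γ.len e := by gcongr
        _ = Γ.len e := one_mul _
    have h5 := abs_lt.1 (show |q i * c e| < Γ.len e / 2 by linarith)
    constructor <;> simp only [t] <;> linarith [h5.1, h5.2]
  let D : ℕ → Γ.Divisor := fun i => ∑ l, Finsupp.single (Γ.edgePoint (ε l) (t i (ε l))) 1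
  -- Outside `A` the defect vanishes, so the points are fixed midpoints and cancel in the
  -- difference.
  have hD : ∀ i j, D i - D j = ∑ e, Finsupp.single (Γ.edgePoint e (t i e)) 1 -
      ∑ e, Finsupp.single (Γ.edgePoint e (t j e)) 1 := by
    intro i j
    simp only [D]
    rw [← Finset.sum_sub_distrib, ← Finset.sum_sub_distrib]
    refine Fintype.sum_of_injective (fun l => (ε l : E))
      (Subtype.val_injective.comp ε.injective) _ _ (fun e he => ?_) fun _ => rfl
    have heA : e ∉ A := fun h => he ⟨ε.symm ⟨e, h⟩, by simp⟩
    simp [t, hcA e heA]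
  have hprin : ∀ i j, ∃ f, Γ.IsPLZ f ∧
      (∀ e, Γ.slopeToHead f e 0 = (q j - q i : ℚ).num * σ e) ∧
      ∀ x, ((((q j - q i : ℚ).den • (D i - D j)) x : ℤ) : ℝ) = Γ.divisorOf f x := by
    intro i j
    -- Multiplying by the denominator of `q j - q i` makes the slopes integral. Consistency along
    -- `e` is the identity `p (head e) - p (tail e) = σ e * len e - c e`, scaled by the numerator.
    obtain ⟨f, hf, hs, hdiv⟩ := exists_isPLZ_of_flow (Γ := Γ)
      (fun v => (q j - q i : ℚ).num * p v) (fun e => (q j - q i : ℚ).num * σ e)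
      (fun v => by rw [← Finset.mul_sum, ← Finset.mul_sum, hflow])
      (q j - q i : ℚ).den (t i) (t j) (ht i) (ht j) (fun e => by
        have h1 : ((q j - q i : ℚ).den : ℝ) * (q j - q i) = (q j - q i : ℚ).num := by
          exact_mod_cast Rat.den_mul_eq_num (q j - q i)
        simp only [t, ← h1, hc]
        push_cast
        rw [← h1]
        ring)
    refine ⟨f, hf, fun e => by rw [hs]; push_cast; rfl, fun x => ?_⟩
    rw [← hdiv x, hD i j, natCast_zsmul]
  refine ⟨fun i l => Γ.edgePoint (ε l) (t i (ε l)), fun i j => ?_, fun i j hij => ?_⟩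
  · obtain ⟨f, hf, -, hdiv⟩ := hprin i j
    refine ⟨(q j - q i : ℚ).den, Rat.den_pos _, ?_⟩
    rw [← map_sub, ← map_nsmul]
    exact (QuotientAddGroup.eq_zero_iff _).2 ⟨f, hf, hdiv⟩
  · obtain ⟨f, hf, hs, hdiv⟩ := hprin i j
    have hij' : D i - D j ∈ Γ.principal :=
      (QuotientAddGroup.eq_zero_iff _).1 (by
        change Γ.divisorClass (D i - D j) = 0
        rw [map_sub]
        exact sub_eq_zero.2 hij)
    obtain ⟨g, hg, hgdiv⟩ := hij'
    set N := (q j - q i : ℚ).den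
    -- `f - N * g` has zero divisor, hence slope zero at the tail of `e₀`; an edge of `C` is chosen
    -- because `σ` is `±1` there.
    have hh := (hf.add (hg.int_mul (-N))).slopeToHead_eq_zero hG (fun x => by
      rw [divisorOf_add hf (hg.int_mul _), divisorOf_int_mul, ← hdiv, ← hgdiv]
      simp) e₀
    rw [slopeToHead, derivWithin_fun_add (hf.differentiable_right e₀ le_rfl (Γ.len_pos e₀))
      ((hg.int_mul _).differentiable_right e₀ le_rfl (Γ.len_pos e₀)),
      derivWithin_const_mul_field] at hh
    obtain ⟨m, hm⟩ := hg.exists_slopeToHead_eq e₀ le_rfl (Γ.len_pos e₀)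
    change Γ.slopeToHead f e₀ 0 + ((-N : ℤ) : ℝ) * Γ.slopeToHead g e₀ 0 = 0 at hh
    rw [hs, hm] at hh
    have hh' : (q j - q i : ℚ).num * σ e₀ = N * m := by
      have : ((q j - q i : ℚ).num : ℝ) * σ e₀ = N * m := by
        push_cast at hh
        linarith
      exact_mod_cast this
    have hN : (N : ℚ) ≠ 0 := by exact_mod_cast (Rat.den_pos _).ne'
    -- Dividing by `N` shows that `q j - q i` is an integer up to sign; lying strictly between `-1`
    -- and `1`, it is zero.
    have hm' : (q j - q i) * σ e₀ = m := by
      have h1 : (N : ℚ) * (q j - q i) = (q j - q i : ℚ).num := Rat.den_mul_eq_num _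
      have h2 : ((q j - q i : ℚ).num : ℚ) * σ e₀ = N * m := by exact_mod_cast hh'
      rw [← h1, mul_assoc] at h2
      exact mul_left_cancel₀ hN h2
    have habs : |(m : ℚ)| < 1 := by
      have h1 : |(σ e₀ : ℚ)| = 1 := by rcases hσ e₀ he₀ with h | h <;> simp [h]
      rw [← hm', abs_mul, h1, mul_one, abs_lt]
      constructor <;> linarith [hq0 i, hq0 j, hq1 i, hq1 j]
    have hm0 : m = 0 := Int.abs_lt_one_iff.1 (by exact_mod_cast habs)
    have hσe : (σ e₀ : ℚ) ≠ 0 := by rcases hσ e₀ he₀ with h | h <;> simp [h]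
    rw [hm0, Int.cast_zero, mul_eq_zero, or_iff_left hσe, sub_eq_zero] at hm'
    exact hqinj hm'.symm

end MetricGraph

/-! ### Failure of Manin–Mumford and the infinite packet -/

theorem mainTheorem5 {V E : Type*} [Fintype V] [Fintype E] (G : Multigraph V E)
    (hG : G.Connected) (C : Set E) (hC : G.IsCycleEdgeSet C) (d : ℕ)
    (hd : (G.cographicMatroid hG).eRk C = d) (len : E → ℝ) (hlen : ∀ e, 0 < len e) :
    ¬ (MetricGraph.mk G len hlen).ManinMumford d ∧
      ∃ c ∈ (MetricGraph.mk G len hlen).Eff d,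
        ((MetricGraph.mk G len hlen).torsionPacket d c).Infinite := by
  set Γ := MetricGraph.mk G len hlen
  obtain ⟨x, htors, hinj⟩  := MetricGraph.exists_torsion_family (Γ := Γ) hG hC hd
  let D : ℕ → Γ.Divisor := fun i => ∑ l, Finsupp.single (x i l) 1
  have hdeg : ∀ i, (D i).degree = d := fun i => by simp [D]
  have hpos : ∀ i, 0 ≤ D i := fun i =>
    Finset.sum_nonneg fun l _ => Finsupp.single_nonneg.2 zero_le_one
  have hJ : ∀ i, IsOfFinAddOrder (Γ.abelJacobi (D 0) (hdeg 0) (x i)) := fun i => by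
    obtain ⟨N, hN, h⟩ := htors i 0
    refine isOfFinAddOrder_iff_nsmul_eq_zero.2 ⟨N, hN, Subtype.ext ?_⟩
    rw [← map_sub] at h
    exact h
  have hval : ∀ i, (Γ.abelJacobi (D 0) (hdeg 0) (x i) : Γ.Pic) =
      Γ.divisorClass (D i) - Γ.divisorClass (D 0) := fun i => map_sub _ _ _
  constructor
  · intro h
    -- With base divisor `D 0`, the Abel–Jacobi image contains the infinitely many torsion points
    -- `[D i - D 0]`.
    refine Set.infinite_of_injective_forall_mem (f := fun i => Γ.abelJacobi (D 0) (hdeg 0) (x i))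
      (fun i j hij => hinj ?_) (fun i => Set.mem_inter (Set.mem_range_self (x i)) (hJ i))
      (h (D 0) (hdeg 0) (hpos 0))
    have := congrArg (Subtype.val) hij
    simp only [hval] at this
    exact sub_left_injective this
  · refine ⟨Γ.divisorClass (D 0), ⟨D 0, hpos 0, hdeg 0, rfl⟩, ?_⟩
    exact Set.infinite_of_injective_forall_mem hinj fun i =>
      ⟨⟨D i, hpos i, hdeg i, rfl⟩, _, hJ i, hval i⟩
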